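/- Let $N\ge 1$, $n\ge 0$. Let $T^a$ ($a=1,\dots,N^2-1$) be generators of $su(N)$ in the physicists' convention, i.e. a real basis of the space of traceless Hermitian complex $N\times N$ matrices, normalized by $\mathrm{Tr}(T^aT^b)=\tfrac12\delta^{ab}$. Let $G^0=\mathbf 1$ be the unit matrix and $G^a=T^a$ for $a=1,\dots,N^2-1$; these form the extended basis of $gl(N,\mathbb C)$. Write $G^{a\,i}_{\;\;\;j}$ for the entry of $G^a$ in row $i$ and column $j$. Let $\Phi$ be an Ad-invariant $n$-form, i.e. either (i) a $\mathbb C$-multilinear form $\Phi(X_1,\dots,X_n)\in\mathbb C$ of $X_1,\dots,X_n\in gl(N,\mathbb C)$ with $\Phi(gX_1g^{-1},\dots,gX_ng^{-1})=\Phi(X_1,\dots,X_n)$ for all $g\in GL(N,\mathbb C)$, or (ii) an $\mathbb R$-multilinear form $\Phi(X_1,\dots,X_n)\in\mathbb C$ of $X_1,\dots,X_n\in u(N)$ (Hermitian $N\times N$ matrices) with $\Phi(UX_1U^{-1},\dots,UX_nU^{-1})=\Phi(X_1,\dots,X_n)$ for all $U\in U(N)$, and let $\Phi^{a_1\ldots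 a_n}=\Phi(G^{a_1},\dots,G^{a_n})$ be its coefficients. Then there are complex numbers $C_P$, one for each permutation $P$ of $\{1,\dots,n\}$, such that for all $i_1,\dots,i_n,j_1,\dots,j_n\in\{1,\dots,N\}$ $$\sum_{a_1,\dots,a_n=0}^{N^2-1}\Phi^{a_1\ldots a_n}\,G^{a_1\,i_1}_{\;\;\;\;\;j_1}\cdots G^{a_n\,i_n}_{\;\;\;\;\;j_n}=\sum_{P}C_P\,\delta^{i_1}_{j_{P(1)}}\cdots\delta^{i_n}_{j_{P(n)}} .$$ -/

import Mathlib

/-- The Lie algebra `u(N)` in the physicists' convention: complex Hermitian `N × N` matrices,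
as a real vector space. -/
def uAlg (N : ℕ) : Submodule ℝ (Matrix (Fin N) (Fin N) ℂ) where
  carrier := {X | X.IsHermitian}
  add_mem' := fun hX hY => Matrix.IsHermitian.add hX hY
  zero_mem' := Matrix.isHermitian_zero
  smul_mem' := fun c X hX => by
    change Matrix.conjTranspose (c • X) = c • X
    rw [Matrix.conjTranspose_smul, star_trivial, hX]

/-- The Lie algebra `su(N)` in the physicists' convention: traceless complex Hermitian
`N × N` matrices, as a real vector space. -/
def suAlg (N : ℕ) : Submodule ℝ (Matrix (Fin N) (Fin N) ℂ) where
  carrier := {X | X.IsHermitian ∧ X.trace = 0}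
  add_mem' := fun hX hY => ⟨hX.1.add hY.1, by rw [Matrix.trace_add, hX.2, hY.2, add_zero]⟩
  zero_mem' := ⟨Matrix.isHermitian_zero, Matrix.trace_zero _ _⟩
  smul_mem' := fun c X hX =>
    ⟨(uAlg N).smul_mem c hX.1, by rw [Matrix.trace_smul, hX.2, smul_zero]⟩

/-- The extended basis `G^a` attached to generators `T^a` of `su(N)`: the extra index
`none` (written `a = 0` in physics) gives the unit matrix, the index `some a` gives `T^a`. -/
def extBasis {N : ℕ} {ι : Type*} (T : ι → suAlg N) : Option ι → uAlg N
  | none => ⟨1, Matrix.isHermitian_one⟩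
  | some a => ⟨(T a : Matrix (Fin N) (Fin N) ℂ), (T a).2.1⟩

/-- The adjoint action `X ↦ U X U⁻¹` of the unitary group `U(N)` on `u(N)`. -/
def unitaryAd {N : ℕ} (U : Matrix.unitaryGroup (Fin N) ℂ) (X : uAlg N) : uAlg N :=
  ⟨(U : Matrix (Fin N) (Fin N) ℂ) * (X : Matrix (Fin N) (Fin N) ℂ) *
      ((U⁻¹ : Matrix.unitaryGroup (Fin N) ℂ) : Matrix (Fin N) (Fin N) ℂ),
    Matrix.isHermitian_mul_mul_conjTranspose (U : Matrix (Fin N) (Fin N) ℂ) X.2⟩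

/-- Ad-invariance of a complex `n`-linear form on `gl(N, ℂ)`. -/
def IsAdInvariantGL {N n : ℕ}
    (Φ : MultilinearMap ℂ (fun _ : Fin n => Matrix (Fin N) (Fin N) ℂ) ℂ) : Prop :=
  ∀ (g : Matrix.GeneralLinearGroup (Fin N) ℂ) (X : Fin n → Matrix (Fin N) (Fin N) ℂ),
    Φ (fun k => (g : Matrix (Fin N) (Fin N) ℂ) * X k *
      ((g⁻¹ : Matrix.GeneralLinearGroup (Fin N) ℂ) : Matrix (Fin N) (Fin N) ℂ)) = Φ X

/-- Ad-invariance of a complex-valued real `n`-linear form on `u(N)`. -/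
def IsAdInvariantU {N n : ℕ}
    (Φ : MultilinearMap ℝ (fun _ : Fin n => uAlg N) ℂ) : Prop :=
  ∀ (U : Matrix.unitaryGroup (Fin N) ℂ) (X : Fin n → uAlg N),
    Φ (fun k => unitaryAd U (X k)) = Φ X

/-- The contraction `Φ^{a₁…aₙ} G^{a₁ i₁}_{j₁} … G^{aₙ iₙ}_{jₙ}`, summed over all `a₁, …, aₙ`,
where the upper index `i` is the row and the lower index `j` the column of a matrix. -/
noncomputable def extContraction {N n : ℕ} {ι : Type*} [Fintype ι] (T : ι → suAlg N)
    (φ : (Fin n → Option ι) → ℂ) (i j : Fin n → Fin N) : ℂ :=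
  ∑ a : Fin n → Option ι,
    φ a * ∏ k : Fin n, (extBasis T (a k) : Matrix (Fin N) (Fin N) ℂ) (i k) (j k)

/-! Read the contraction as a matrix `A` on the tensor power `(ℂ^N)^{⊗n}`; the claim is Schur-Weyl
duality for `A`. Since the adjoint representation is orthogonal in the extended basis, invariance of
`Φ` makes `A` commute with every `U^{⊗n}`, `U` unitary (`extContraction_commute_unitary`). The
entries of this commutation relation are polynomials in those of `U`, and unitary matrices are
Zariski dense, so it holds for a generic matrix. Comparing monomials, `A` commutes with the whole
commutant of `S_n` (`commute_of_commute_unitary`). The tensor power is semisimple over `ℂ[S_n]`, so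
Jacobson density puts `A` in the image of `ℂ[S_n]` (`exists_sum_perm_of_commute`). -/

/-- The Kronecker product of a family of matrices, acting on the `n`-fold tensor power. -/
def tensorMatrix {N n : ℕ} (X : Fin n → Matrix (Fin N) (Fin N) ℂ) :
    Matrix (Fin n → Fin N) (Fin n → Fin N) ℂ :=
  Matrix.of fun i j => ∏ k, X k (i k) (j k)

theorem tensorMatrix_mul {N n : ℕ} (X Y : Fin n → Matrix (Fin N) (Fin N) ℂ) :
    tensorMatrix X * tensorMatrix Y = tensorMatrix fun k => X k * Y k := by
  ext i j
  simp only [tensorMatrix, Matrix.mul_apply, Matrix.of_apply, Finset.prod_univ_sum,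
    Fintype.piFinset_univ, Finset.prod_mul_distrib]

theorem tensorMatrix_one {N n : ℕ} :
    tensorMatrix (fun _ : Fin n => (1 : Matrix (Fin N) (Fin N) ℂ)) = 1 := by
  ext i j
  simp only [tensorMatrix, Matrix.of_apply, Matrix.one_apply, Finset.prod_ite_zero,
    Finset.prod_const_one, Finset.mem_univ, true_imp_iff, funext_iff]

/-! ### Double commutant of the symmetric group -/

/-- The representation of the symmetric group on the tensor power of `ℂ^N` by permutation of the
tensor factors. -/
def permRep (N n : ℕ) : Representation ℂ (Equiv.Perm (Fin n)) ((Fin n → Fin N) → ℂ) where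
  toFun σ := LinearMap.funLeft ℂ ℂ (fun i => i ∘ σ)
  map_one' := rfl
  map_mul' _ _ := rfl

theorem permRep_apply {N n : ℕ} (σ : Equiv.Perm (Fin n)) (v : (Fin n → Fin N) → ℂ)
    (i : Fin n → Fin N) : permRep N n σ v i = v (i ∘ σ) := rfl

/-- A matrix on the tensor power commuting with the commutant of the symmetric group is a linear
combination of permutations of the tensor factors. -/
theorem exists_sum_perm_of_commute {N n : ℕ} (A : Matrix (Fin n → Fin N) (Fin n → Fin N) ℂ)
    (hA : ∀ B : Matrix (Fin n → Fin N) (Fin n → Fin N) ℂ,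
      (∀ (σ : Equiv.Perm (Fin n)) (i j), B (i ∘ σ) (j ∘ σ) = B i j) → A * B = B * A) :
    ∃ C : Equiv.Perm (Fin n) → ℂ, ∀ i j : Fin n → Fin N,
      A i j = ∑ P : Equiv.Perm (Fin n), C P * ∏ k : Fin n, (if i k = j (P k) then (1 : ℂ) else 0) := by
  classical
  let ρ := permRep N n
  let f : Module.End (Module.End (MonoidAlgebra ℂ (Equiv.Perm (Fin n))) ρ.asModule)
      ρ.asModule :=
    { toFun := fun v => ρ.asModuleEquiv.symm (A.mulVec (ρ.asModuleEquiv v))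
      map_add' := fun v w => by simp only [map_add, Matrix.mulVec_add]
      map_smul' := fun g v => by
        let g' : ((Fin n → Fin N) → ℂ) →ₗ[ℂ] ((Fin n → Fin N) → ℂ) :=
          ρ.asModuleEquiv.toLinearMap ∘ₗ (g.restrictScalars ℂ) ∘ₗ
            ρ.asModuleEquiv.symm.toLinearMap
        have hg' : ∀ (σ : Equiv.Perm (Fin n)) w, g' (ρ σ w) = ρ σ (g' w) := by
          intro σ w
          simp only [g', LinearMap.comp_apply, LinearEquiv.coe_coe,
            LinearMap.coe_restrictScalars]
          rw [Representation.asModuleEquiv_symm_map_rho, map_smul,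
            Representation.asModuleEquiv_map_smul, Representation.asAlgebraHom_of]
        have hB := hA (LinearMap.toMatrix' g') (by
          intro σ i j
          simp only [LinearMap.toMatrix'_apply]
          have h := congrFun (hg' σ (Pi.single (j ∘ σ) 1)) i
          rw [permRep_apply] at h
          rw [← h]
          refine congrFun (congrArg g' (funext fun l => ?_)) i
          simp only [ρ, permRep_apply, Pi.single_apply]
          have : l ∘ σ = j ∘ σ ↔ l = j := σ.surjective.injective_comp_right.eq_iff
          simp only [this])
        have h2 : ∀ w, A.mulVec (g' w) = g' (A.mulVec w) := by
          intro w
          have := congrArg (fun M => M.mulVec w) hB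
          simpa only [← Matrix.mulVec_mulVec, LinearMap.toMatrix'_mulVec] using this
        have h3 := h2 (ρ.asModuleEquiv v)
        simp only [g', LinearMap.comp_apply, LinearEquiv.coe_coe,
            LinearMap.coe_restrictScalars, LinearEquiv.symm_apply_apply] at h3
        simp only [RingHom.id_apply, Module.End.smul_def]
        rw [h3, LinearEquiv.symm_apply_apply] }
  -- An element of `ℂ[S_n]` agreeing with `f` on the standard basis agrees with it everywhere.
  obtain ⟨r, hr⟩ := jacobson_density f
    (Finset.univ.image fun j : Fin n → Fin N => ρ.asModuleEquiv.symm (Pi.single j 1))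
  -- The inverse appears because `ρ σ` sends the basis vector at `j` to the one at `j ∘ σ⁻¹`.
  refine ⟨fun P => r.coeff P⁻¹, fun i j => ?_⟩
  have h := hr _ (Finset.mem_image_of_mem _ (Finset.mem_univ j))
  have h := congrFun (congrArg ρ.asModuleEquiv h) i
  simp only [f, LinearMap.coe_mk, AddHom.coe_mk, LinearEquiv.apply_symm_apply,
    Matrix.mulVec_single_one, Representation.asModuleEquiv_map_smul] at h
  rw [Matrix.col_apply] at h
  rw [h, Representation.asAlgebraHom_def, MonoidAlgebra.lift_apply, Finsupp.sum_fintype _ _ (by simp)]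
  rw [← Equiv.sum_comp (Equiv.inv (Equiv.Perm (Fin n)))]
  simp only [LinearMap.sum_apply, LinearMap.smul_apply, Finset.sum_apply, Pi.smul_apply,
    smul_eq_mul, ρ, permRep_apply, Equiv.inv_apply]
  refine Finset.sum_congr rfl fun P _ => ?_
  congr 1
  rw [Finset.prod_ite_zero, Pi.single_apply]
  simp only [Finset.prod_const_one, Finset.mem_univ, true_imp_iff, funext_iff]
  refine if_congr ⟨fun h k => ?_, fun h k => ?_⟩ rfl rfl
  · simpa using h (P k)
  · simpa using h (P⁻¹ k)

/-! ### Zariski density of the unitary group -/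

theorem infinite_setOf_mul_conj_eq_one : {z : ℂ | z * star z = 1}.Infinite := by
  refine Set.Infinite.of_image Complex.re ((Set.Icc_infinite (zero_lt_one' ℝ)).mono ?_)
  rintro t ⟨h0, h1⟩
  refine ⟨⟨t, √(1 - t ^ 2)⟩, ?_, rfl⟩
  have h : √(1 - t ^ 2) * √(1 - t ^ 2) = 1 - t ^ 2 := Real.mul_self_sqrt (by nlinarith)
  apply Complex.ext
  · simp [h]
    ring
  · simp
    ring

/-- A polynomial in the matrix entries vanishing on all unitary matrices is zero. -/
theorem mvPolynomial_eq_zero_of_unitary {N : ℕ} (p : MvPolynomial (Fin N × Fin N) ℂ)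
    (hp : ∀ U ∈ Matrix.unitaryGroup (Fin N) ℂ, MvPolynomial.eval (fun x => U x.1 x.2) p = 0) :
    p = 0 := by
  have hH : ∀ H : Matrix (Fin N) (Fin N) ℂ, H.IsHermitian →
      MvPolynomial.eval (fun x => H x.1 x.2) p = 0 := by
    intro H hH
    let V := hH.eigenvectorUnitary
    -- `q` is `p` at `V diag(d) V*`. It vanishes for `d` on the unit torus, hence identically, in
    -- particular at the eigenvalues of `H`.
    let q : MvPolynomial (Fin N) ℂ := MvPolynomial.bind₁ (fun x : Fin N × Fin N =>
      ∑ k, MvPolynomial.C ((V : Matrix (Fin N) (Fin N) ℂ) x.1 k *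
        star ((V : Matrix (Fin N) (Fin N) ℂ) x.2 k)) * MvPolynomial.X k) p
    have hq : ∀ d : Fin N → ℂ, MvPolynomial.eval d q = MvPolynomial.eval (fun x =>
        ((V : Matrix (Fin N) (Fin N) ℂ) * Matrix.diagonal d *
          star (V : Matrix (Fin N) (Fin N) ℂ)) x.1 x.2) p := by
      intro d
      simp only [q, MvPolynomial.eval, MvPolynomial.eval₂Hom_bind₁]
      congr 2
      ext x
      simp only [map_sum, map_mul, MvPolynomial.eval₂Hom_C, MvPolynomial.eval₂Hom_X',
        Matrix.mul_apply (M := _ * _), Matrix.mul_diagonal, Matrix.star_apply, RingHom.id_apply]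
      exact Finset.sum_congr rfl fun k _ => by ring
    have hq0 : q = 0 := by
      refine MvPolynomial.funext_set (fun _ => {z : ℂ | z * star z = 1})
        (fun _ => infinite_setOf_mul_conj_eq_one) fun d hd => ?_
      rw [hq, map_zero]
      refine hp _ (mul_mem (mul_mem V.2 ?_) (Unitary.star_mem V.2))
      rw [Matrix.mem_unitaryGroup_iff, Matrix.star_eq_conjTranspose, Matrix.diagonal_conjTranspose,
        Matrix.diagonal_mul_diagonal, ← Matrix.diagonal_one]
      congr 1
      ext k
      exact hd k (Set.mem_univ k)
    have h := hq (RCLike.ofReal ∘ hH.eigenvalues)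
    rw [hq0, map_zero] at h
    rw [h]
    congr 2
    have := hH.spectral_theorem
    rw [Unitary.conjStarAlgAut_apply] at this
    ext x
    exact congrFun (congrFun this x.1) x.2
  refine MvPolynomial.funext fun x => ?_
  rw [map_zero]
  let X : Matrix (Fin N) (Fin N) ℂ := Matrix.of fun i j => x (i, j)
  -- `X = H₁ + i H₂` with Hermitian parts; `p` vanishes at `H₁ + t H₂` for all real `t`, hence also
  -- at `t = i`.
  let H₁ : Matrix (Fin N) (Fin N) ℂ := (1 / 2 : ℂ) • (X + X.conjTranspose)
  let H₂ : Matrix (Fin N) (Fin N) ℂ := (-Complex.I / 2) • (X - X.conjTranspose)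
  let q : Polynomial ℂ := MvPolynomial.aeval (fun y : Fin N × Fin N =>
    Polynomial.C (H₁ y.1 y.2) + Polynomial.X * Polynomial.C (H₂ y.1 y.2)) p
  have hq : ∀ t : ℂ, q.eval t =
      MvPolynomial.eval (fun y => (H₁ + t • H₂) y.1 y.2) p := by
    intro t
    have := MvPolynomial.map_aeval (fun y : Fin N × Fin N =>
      Polynomial.C (H₁ y.1 y.2) + Polynomial.X * Polynomial.C (H₂ y.1 y.2))
      (Polynomial.evalRingHom t) p
    simp only [Polynomial.coe_evalRingHom] at this
    rw [this, MvPolynomial.eval]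
    congr 2
    · ext
      · simp
    · ext y
      simpa using mul_comm _ _
  have hq0 : q = 0 := by
    refine Polynomial.eq_zero_of_infinite_isRoot q
      ((Set.infinite_range_of_injective Complex.ofReal_injective).mono ?_)
    rintro _ ⟨t, rfl⟩
    rw [Set.mem_ofPred_eq, Polynomial.IsRoot, hq]
    refine hH _ ?_
    ext i j
    simp [H₁, H₂, X]
    ring
  have h := hq Complex.I
  rw [hq0, Polynomial.eval_zero] at h
  rw [h]
  congr 2
  ext y
  simp only [H₁, H₂, X, Matrix.add_apply, Matrix.smul_apply, Matrix.sub_apply, smul_eq_mul,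
    Matrix.conjTranspose_apply, Matrix.of_apply]
  linear_combination (1 / 2 : ℂ) * (x y - star (x (y.2, y.1))) * Complex.I_mul_I

/-! ### From tensor powers of unitaries to the commutant of the symmetric group -/

/-- Equal multiplicities make the fibres equinumerous, and bijections between them glue to `σ`. Thus
a monomial in the matrix entries fixes its list of index pairs up to order. -/
theorem exists_perm_of_sum_single_eq {α : Type*} {n : ℕ} {x y : Fin n → α}
    (h : ∑ k, Finsupp.single (x k) 1 = ∑ k, Finsupp.single (y k) (1 : ℕ)) :
    ∃ σ : Equiv.Perm (Fin n), x = y ∘ σ := by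
  classical
  have hcard : ∀ a, Fintype.card {k // x k = a} = Fintype.card {k // y k = a} := by
    intro a
    have := DFunLike.congr_fun h a
    simpa only [Finsupp.finsetSum_apply, Finsupp.single_apply, Finset.sum_boole, Nat.cast_id,
      Fintype.card_subtype] using this
  exact ⟨Equiv.ofFiberEquiv fun a => Fintype.equivOfCardEq (hcard a),
    funext fun k => (Equiv.ofFiberEquiv_map _ k).symm⟩

/-- A matrix commuting with all tensor powers of unitary matrices commutes with the commutant of
the symmetric group. -/
theorem commute_of_commute_unitary {N n : ℕ} (A : Matrix (Fin n → Fin N) (Fin n → Fin N) ℂ)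
    (hA : ∀ U ∈ Matrix.unitaryGroup (Fin N) ℂ,
      A * tensorMatrix (fun _ => U) = tensorMatrix (fun _ => U) * A)
    (B : Matrix (Fin n → Fin N) (Fin n → Fin N) ℂ)
    (hB : ∀ (σ : Equiv.Perm (Fin n)) (i j), B (i ∘ σ) (j ∘ σ) = B i j) : A * B = B * A := by
  classical
  let mon : (Fin n → Fin N) → (Fin n → Fin N) → ((Fin N × Fin N) →₀ ℕ) :=
    fun i j => ∑ k, Finsupp.single (i k, j k) 1
  let c : ((Fin N × Fin N) →₀ ℕ) → ℂ := fun m =>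
    if h : ∃ x : (Fin n → Fin N) × (Fin n → Fin N), mon x.1 x.2 = m
    then B h.choose.1 h.choose.2 else 0
  have hc : ∀ i j, c (mon i j) = B i j := by
    intro i j
    have h : ∃ x : (Fin n → Fin N) × (Fin n → Fin N), mon x.1 x.2 = mon i j := ⟨(i, j), rfl⟩
    simp only [c]
    rw [dif_pos h]
    obtain ⟨σ, hσ⟩ := exists_perm_of_sum_single_eq h.choose_spec
    rw [← hB σ i j]
    congr 1
    · exact congrArg (fun z k => (z k).1) hσ
    · exact congrArg (fun z k => (z k).2) hσ
  -- This functional replaces each entry of the generic `X^{⊗n}` by that of `B`; it is well defined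
  -- because `B` is constant on orbits of `S_n`.
  let L : MvPolynomial (Fin N × Fin N) ℂ →ₗ[ℂ] ℂ :=
    (MvPolynomial.basisMonomials (Fin N × Fin N) ℂ).constr ℂ c
  have hL : ∀ i j : Fin n → Fin N,
      L (∏ k, MvPolynomial.X (i k, j k)) = B i j := by
    intro i j
    have : (∏ k, MvPolynomial.X (i k, j k) : MvPolynomial (Fin N × Fin N) ℂ) =
        MvPolynomial.basisMonomials (Fin N × Fin N) ℂ (mon i j) := by
      rw [MvPolynomial.coe_basisMonomials]
      simp only [mon, MvPolynomial.X]
      rw [MvPolynomial.monomial_sum_one]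
    rw [this, Module.Basis.constr_basis, hc]
  ext i j
  -- The `(i, j)` entry of the commutator of `A` with `X^{⊗n}`, `X` generic; `L` turns it into that
  -- of `A` with `B`.
  let p : MvPolynomial (Fin N × Fin N) ℂ :=
    ∑ l, A i l • ∏ k, MvPolynomial.X (l k, j k) - ∑ l, A l j • ∏ k, MvPolynomial.X (i k, l k)
  have hp : p = 0 := by
    refine mvPolynomial_eq_zero_of_unitary p fun U hU => ?_
    have := congrFun (congrFun (hA U hU) i) j
    simp only [Matrix.mul_apply, tensorMatrix, Matrix.of_apply] at this
    simp only [p, map_sub, map_sum, MvPolynomial.smul_eval, map_prod, MvPolynomial.eval_X, this]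
    rw [sub_eq_zero]
    exact Finset.sum_congr rfl fun l _ => mul_comm _ _
  have h := congrArg L hp
  simp only [p, map_sub, map_sum, map_smul, hL, map_zero, smul_eq_mul, sub_eq_zero] at h
  simp only [Matrix.mul_apply, h]
  exact Finset.sum_congr rfl fun l _ => mul_comm _ _

/-! ### The adjoint representation in the extended basis -/

/-- The coefficients of a Hermitian matrix in the extended basis. -/
noncomputable def extCoeff {N : ℕ} {ι : Type*} (T : ι → suAlg N) : Option ι → uAlg N → ℝ
  | none, X => (X : Matrix (Fin N) (Fin N) ℂ).trace.re / N
  | some b, X => 2 * ((X : Matrix (Fin N) (Fin N) ℂ) * (T b : Matrix (Fin N) (Fin N) ℂ)).trace.re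

/-- Removing the trace part leaves an element of `su(N)`, whose coordinates come from pairing with
`T b`; the factor 2 undoes the normalization 1/2. -/
theorem sum_extCoeff_smul {N : ℕ} (hN : 1 ≤ N) {ι : Type*} [Fintype ι] [DecidableEq ι]
    (T : Module.Basis ι ℝ (suAlg N))
    (hT : ∀ a b : ι, ((T a : Matrix (Fin N) (Fin N) ℂ) * (T b : Matrix (Fin N) (Fin N) ℂ)).trace =
      if a = b then (1 / 2 : ℂ) else 0) (X : uAlg N) :
    X = ∑ b, extCoeff T b X • extBasis T b := by
  have hN' : (N : ℂ) ≠ 0 := by exact_mod_cast (by omega : N ≠ 0)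
  have htr : ((X : Matrix (Fin N) (Fin N) ℂ).trace.re : ℂ) =
      (X : Matrix (Fin N) (Fin N) ℂ).trace := by
    rw [← Complex.conj_eq_iff_re, starRingEnd_apply, ← Matrix.trace_conjTranspose]
    exact congrArg _ X.2
  let t : ℝ := (X : Matrix (Fin N) (Fin N) ℂ).trace.re / N
  have ht : (t : ℂ) = (X : Matrix (Fin N) (Fin N) ℂ).trace / N := by
    simp only [t, Complex.ofReal_div, htr, Complex.ofReal_natCast]
  let Y : suAlg N := ⟨(X : Matrix (Fin N) (Fin N) ℂ) - t • 1, by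
    refine ⟨(X - t • (⟨1, Matrix.isHermitian_one⟩ : uAlg N)).2, ?_⟩
    rw [Matrix.trace_sub, Matrix.trace_smul, Matrix.trace_one, Fintype.card_fin,
      Complex.real_smul, ht]
    field_simp
    ring⟩
  have hTtr : ∀ b, (T b : Matrix (Fin N) (Fin N) ℂ).trace = 0 := fun b => (T b).2.2
  have hY : (Y : Matrix (Fin N) (Fin N) ℂ) =
      ∑ a, T.repr Y a • (T a : Matrix (Fin N) (Fin N) ℂ) := by
    conv_lhs => rw [← T.sum_repr Y]
    simp only [Submodule.coe_sum, Submodule.coe_smul]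
  have hrepr : ∀ b, T.repr Y b = extCoeff T (some b) X := by
    intro b
    have h1 : ((Y : Matrix (Fin N) (Fin N) ℂ) * (T b : Matrix (Fin N) (Fin N) ℂ)).trace =
        (T.repr Y b : ℂ) / 2 := by
      rw [hY]
      simp only [Finset.sum_mul, Matrix.trace_sum, Matrix.smul_mul, Matrix.trace_smul, hT,
        smul_ite, smul_zero, Finset.sum_ite_eq', Finset.mem_univ, if_true, Complex.real_smul]
      ring
    have h2 : ((Y : Matrix (Fin N) (Fin N) ℂ) * (T b : Matrix (Fin N) (Fin N) ℂ)).trace =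
        ((X : Matrix (Fin N) (Fin N) ℂ) * (T b : Matrix (Fin N) (Fin N) ℂ)).trace := by
      simp only [Y, Matrix.sub_mul, Matrix.trace_sub, Matrix.smul_mul, Matrix.one_mul,
        Matrix.trace_smul, hTtr, smul_zero, sub_zero]
    simp only [extCoeff, ← h2, h1]
    norm_num
    ring
  apply Subtype.ext
  rw [Fintype.sum_option]
  simp only [← hrepr, Submodule.coe_add, Submodule.coe_sum, Submodule.coe_smul, extBasis]
  rw [← hY]
  simp only [Y, extCoeff, t]
  abel

theorem coe_unitaryAd {N : ℕ} (U : Matrix.unitaryGroup (Fin N) ℂ) (X : uAlg N) :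
    (unitaryAd U X : Matrix (Fin N) (Fin N) ℂ) =
      (U : Matrix (Fin N) (Fin N) ℂ) * X * star (U : Matrix (Fin N) (Fin N) ℂ) := rfl

/-- The adjoint representation is orthogonal in the extended basis. -/
theorem extCoeff_unitaryAd {N : ℕ} {ι : Type*} (T : ι → suAlg N)
    (U : Matrix.unitaryGroup (Fin N) ℂ) (a b : Option ι) :
    extCoeff T a (unitaryAd U⁻¹ (extBasis T b)) = extCoeff T b (unitaryAd U (extBasis T a)) := by
  have hTtr : ∀ b, (T b : Matrix (Fin N) (Fin N) ℂ).trace = 0 := fun b => (T b).2.2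
  have hU : star (U : Matrix (Fin N) (Fin N) ℂ) * (U : Matrix (Fin N) (Fin N) ℂ) = 1 :=
    Matrix.UnitaryGroup.star_mul_self U
  have hU' : (U : Matrix (Fin N) (Fin N) ℂ) * star (U : Matrix (Fin N) (Fin N) ℂ) = 1 :=
    Matrix.mem_unitaryGroup_iff.1 U.2
  -- The unit matrix and the `T a` are normalized differently, but this is harmless: the mixed
  -- coefficients vanish by tracelessness.
  rcases a with _ | a <;> rcases b with _ | b <;>
    simp only [extCoeff, coe_unitaryAd, extBasis, Matrix.UnitaryGroup.inv_val, star_star,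
      mul_one, hU, hU', one_mul]
  · rw [Matrix.trace_mul_cycle, hU', one_mul, hTtr]; simp
  · rw [Matrix.trace_mul_cycle, hU, one_mul, hTtr]; simp
  · congr 2
    rw [Matrix.trace_mul_comm, ← mul_assoc, ← mul_assoc, Matrix.trace_mul_cycle, ← mul_assoc]

/-- Moves a linear substitution from one factor of a contraction to the other, at the price of
transposing `R`. -/
theorem sum_map_mul_map_eq {E : Type*} [AddCommGroup E] [Module ℝ E] {n : ℕ} {κ : Type*}
    [Fintype κ] (Φ Ψ : MultilinearMap ℝ (fun _ : Fin n => E) ℂ) (G y z : κ → E)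
    (R : κ → κ → ℝ) (hy : ∀ a, y a = ∑ b, R a b • G b) (hz : ∀ b, z b = ∑ a, R a b • G a) :
    ∑ a : Fin n → κ, Φ (fun k => G (a k)) * Ψ (fun k => y (a k)) =
      ∑ b : Fin n → κ, Φ (fun k => z (b k)) * Ψ (fun k => G (b k)) := by
  classical
  simp only [hy, hz, MultilinearMap.map_sum, MultilinearMap.map_smul_univ, Finset.mul_sum,
    Finset.sum_mul]
  rw [Finset.sum_comm]
  refine Finset.sum_congr rfl fun a _ => Finset.sum_congr rfl fun b _ => ?_
  rw [mul_smul_comm, smul_mul_assoc]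

/-- The product of matrix entries, as a multilinear form. -/
noncomputable def entryForm {N n : ℕ} (i j : Fin n → Fin N) : MultilinearMap ℝ (fun _ : Fin n => uAlg N) ℂ :=
  (MultilinearMap.mkPiAlgebra ℝ (Fin n) ℂ).compLinearMap fun k =>
    (Matrix.entryLinearMap ℝ ℂ (i k) (j k)).comp (uAlg N).subtype

theorem entryForm_apply {N n : ℕ} (i j : Fin n → Fin N) (X : Fin n → uAlg N) :
    entryForm i j X = tensorMatrix (fun k => (X k : Matrix (Fin N) (Fin N) ℂ)) i j := by
  simp [entryForm, tensorMatrix]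

theorem extContraction_commute_unitary {N n : ℕ} (hN : 1 ≤ N) {ι : Type*} [Fintype ι]
    [DecidableEq ι] (T : Module.Basis ι ℝ (suAlg N))
    (hT : ∀ a b : ι, ((T a : Matrix (Fin N) (Fin N) ℂ) * (T b : Matrix (Fin N) (Fin N) ℂ)).trace =
      if a = b then (1 / 2 : ℂ) else 0)
    (Φ : MultilinearMap ℝ (fun _ : Fin n => uAlg N) ℂ) (hΦ : IsAdInvariantU Φ)
    (U : Matrix.unitaryGroup (Fin N) ℂ) :
    Matrix.of (extContraction T (fun a => Φ (fun k => extBasis T (a k)))) *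
        tensorMatrix (fun _ => (U : Matrix (Fin N) (Fin N) ℂ)) =
      tensorMatrix (fun _ => (U : Matrix (Fin N) (Fin N) ℂ)) *
        Matrix.of (extContraction T (fun a => Φ (fun k => extBasis T (a k)))) := by
  set A := Matrix.of (extContraction T (fun a => Φ (fun k => extBasis T (a k)))) with hAdef
  have hA : A = ∑ a : Fin n → Option ι, Φ (fun k => extBasis T (a k)) •
      tensorMatrix (fun k => (extBasis T (a k) : Matrix (Fin N) (Fin N) ℂ)) := by
    ext i j
    simp only [hAdef, extContraction, Matrix.of_apply, Matrix.sum_apply, Matrix.smul_apply,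
      smul_eq_mul, tensorMatrix]
  have hconj : tensorMatrix (fun _ => (U : Matrix (Fin N) (Fin N) ℂ)) * A *
      tensorMatrix (fun _ => star (U : Matrix (Fin N) (Fin N) ℂ)) = A := by
    rw [hA]
    simp only [Finset.mul_sum, Finset.sum_mul, Matrix.mul_smul, Matrix.smul_mul,
      tensorMatrix_mul, ← coe_unitaryAd]
    ext i j
    simp only [Matrix.sum_apply, Matrix.smul_apply, smul_eq_mul, ← entryForm_apply]
    -- By orthogonality the transpose of `Ad U` is `Ad U⁻¹`, which then acts on the arguments of `Φ`
    -- and is absorbed by invariance.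
    rw [sum_map_mul_map_eq Φ (entryForm i j) (extBasis T) (fun a => unitaryAd U (extBasis T a))
      (fun a => unitaryAd U⁻¹ (extBasis T a))
      (fun a b => extCoeff T b (unitaryAd U (extBasis T a)))
      (fun a => sum_extCoeff_smul hN T hT _)
      (fun b => by
        refine (sum_extCoeff_smul hN T hT _).trans (Finset.sum_congr rfl fun a _ => ?_)
        rw [extCoeff_unitaryAd])]
    simp only [hΦ U⁻¹ (fun k => extBasis T _)]
  conv_lhs => rw [← hconj]
  rw [mul_assoc, tensorMatrix_mul]
  simp only [Matrix.UnitaryGroup.star_mul_self, tensorMatrix_one, mul_one]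

theorem exists_extContraction_eq_sum_perm {N n : ℕ} (hN : 1 ≤ N) {ι : Type*} [Fintype ι]
    [DecidableEq ι] (T : Module.Basis ι ℝ (suAlg N))
    (hT : ∀ a b : ι, ((T a : Matrix (Fin N) (Fin N) ℂ) * (T b : Matrix (Fin N) (Fin N) ℂ)).trace =
      if a = b then (1 / 2 : ℂ) else 0)
    (Φ : MultilinearMap ℝ (fun _ : Fin n => uAlg N) ℂ) (hΦ : IsAdInvariantU Φ) :
    ∃ C : Equiv.Perm (Fin n) → ℂ, ∀ i j : Fin n → Fin N,
      extContraction T (fun a => Φ (fun k => extBasis T (a k))) i j =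
        ∑ P : Equiv.Perm (Fin n), C P * ∏ k : Fin n, (if i k = j (P k) then (1 : ℂ) else 0) :=
  exists_sum_perm_of_commute (Matrix.of _) (commute_of_commute_unitary _ fun U hU =>
    extContraction_commute_unitary hN T hT Φ hΦ ⟨U, hU⟩)

theorem mainTheorem6 (N n : ℕ) (hN : 1 ≤ N) {ι : Type*} [Fintype ι] [DecidableEq ι]
    (T : Module.Basis ι ℝ (suAlg N))
    (hT : ∀ a b : ι, ((T a : Matrix (Fin N) (Fin N) ℂ) * (T b : Matrix (Fin N) (Fin N) ℂ)).trace =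
      if a = b then (1 / 2 : ℂ) else 0) :
    (∀ Φ : MultilinearMap ℂ (fun _ : Fin n => Matrix (Fin N) (Fin N) ℂ) ℂ, IsAdInvariantGL Φ →
      ∃ C : Equiv.Perm (Fin n) → ℂ, ∀ i j : Fin n → Fin N,
        extContraction T
            (fun a => Φ (fun k => (extBasis T (a k) : Matrix (Fin N) (Fin N) ℂ))) i j =
          ∑ P : Equiv.Perm (Fin n), C P * ∏ k : Fin n, (if i k = j (P k) then (1 : ℂ) else 0)) ∧
    (∀ Φ : MultilinearMap ℝ (fun _ : Fin n => uAlg N) ℂ, IsAdInvariantU Φ →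
      ∃ C : Equiv.Perm (Fin n) → ℂ, ∀ i j : Fin n → Fin N,
        extContraction T (fun a => Φ (fun k => extBasis T (a k))) i j =
          ∑ P : Equiv.Perm (Fin n), C P * ∏ k : Fin n, (if i k = j (P k) then (1 : ℂ) else 0)) := by
  refine ⟨fun Φ hΦ => ?_, fun Φ hΦ => exists_extContraction_eq_sum_perm hN T hT Φ hΦ⟩
  -- Restricting a `GL`-invariant form to Hermitian arguments and unitary `g` reduces case (i) to
  -- case (ii) with the same coefficients.
  refine exists_extContraction_eq_sum_perm hN T hT
    ((Φ.restrictScalars ℝ).compLinearMap fun _ => (uAlg N).subtype) fun U X => ?_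
  exact hΦ (Unitary.toUnits U) fun k => X k
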